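/- Let $N\ge 2$, let $\kappa\in\mathbb{C}$ with $\kappa\notin\{-1,-2,-3,\dots\}$, and consider polynomials in $x_1,\dots,x_N$ with complex coefficients. Let the transposition $(i,j)$ act by interchanging $x_i$ and $x_j$, and for $1\le i\le N$ let \[ \mathcal{D}_i f=\frac{\partial f}{\partial x_i}+\kappa\sum_{j\ne i}\frac{f-(i,j)f}{x_i-x_j} \] be the Dunkl operators. For integers $m,n\ge 0$ let $p_{mn}$ be the polynomials defined by \[ \sum_{m,n=0}^{\infty}p_{mn}\,s^mt^n=(1-sx_1)^{-1}(1-tx_2)^{-1}\prod_{i=1}^{N}\bigl((1-sx_i)(1-tx_i)\bigr)^{-\kappa}. \] With $(a)_j=\prod_{i=1}^{j}(a+i-1)$, let for $m\ge n\ge 0$ \[ \omega_{mn}=p_{mn}+\sum_{j=1}^{n}\frac{(-\kappa)_j\,(m-n+1)_{j-1}}{(\kappa+m-n+1)_j\,j!}\bigl((m-n+j)\,p_{m+j,n-j}+j\,p_{n-j,m+j}\bigr),\qquad \omega_{nm}=(1,2)\,\omega_{mn}, \] and let $\omega_{mn}=0$ if $m<0$ or $n<0$. Then, for all integers $m,n\ge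 0$: 1. if $m>n$, then \[ \mathcal{D}_1\omega_{mn}=(N\kappa+m)\,\omega_{m-1,n}+\frac{((N-1)\kappa+n)\,\kappa}{\kappa+m-n}\Bigl(\omega_{n-1,m}-\frac{\kappa}{\kappa+m-n+1}\,\omega_{m,n-1}\Bigr); \] 2. if $m\ge n$, then \[ \mathcal{D}_2\omega_{mn}=((N-1)\kappa+n)\Bigl(\omega_{m,n-1}-\frac{\kappa}{\kappa+m-n+1}\,\omega_{n-1,m}\Bigr); \] 3. \[ \mathcal{D}_1\omega_{nn}=((N-1)\kappa+n)\Bigl(\omega_{n-1,n}-\frac{\kappa}{\kappa+1}\,\omega_{n,n-1}\Bigr). \] -/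

import Mathlib

namespace SymJack

noncomputable section

open MvPolynomial

/-- The transposition `(i, j)` acting on polynomials by interchanging `x_i` and `x_j`. -/
def transp {N : ℕ} (i j : Fin N) (f : MvPolynomial (Fin N) ℂ) : MvPolynomial (Fin N) ℂ :=
  rename (Equiv.swap i j) f

theorem sub_dvd_sub_transp {N : ℕ} (i j : Fin N) (f : MvPolynomial (Fin N) ℂ) :
    (X i - X j : MvPolynomial (Fin N) ℂ) ∣ f - transp i j f := by
  unfold transp
  induction f using MvPolynomial.induction_on with
  | C a => simp
  | add p q hp hq =>
    have h := dvd_add hp hq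
    rw [map_add]
    convert h using 1
    ring
  | mul_X p k hp =>
    have hk : (X i - X j : MvPolynomial (Fin N) ℂ) ∣ X k - X (Equiv.swap i j k) := by
      by_cases h1 : k = i
      · subst h1; simp
      · by_cases h2 : k = j
        · subst h2
          rw [Equiv.swap_apply_right]
          exact (dvd_sub_comm).mp dvd_rfl
        · rw [Equiv.swap_apply_of_ne_of_ne h1 h2]; simp
    have h := dvd_add (hp.mul_right (X k)) (hk.mul_left (rename (Equiv.swap i j) p))
    rw [map_mul, rename_X]
    convert h using 1
    ring

/-- The polynomial `(f - (i, j) f) / (x_i - x_j)` (used only for `i ≠ j`). -/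
def divDiff {N : ℕ} (i j : Fin N) (f : MvPolynomial (Fin N) ℂ) : MvPolynomial (Fin N) ℂ :=
  (sub_dvd_sub_transp i j f).choose

theorem sub_mul_divDiff {N : ℕ} (i j : Fin N) (f : MvPolynomial (Fin N) ℂ) :
    (X i - X j) * divDiff i j f = f - transp i j f :=
  (sub_dvd_sub_transp i j f).choose_spec.symm

/-- For `i ≠ j` the quotient is uniquely determined. -/
theorem divDiff_eq {N : ℕ} {i j : Fin N} (hij : i ≠ j) {f g : MvPolynomial (Fin N) ℂ}
    (h : (X i - X j) * g = f - transp i j f) : divDiff i j f = g := by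
  have hne : (X i - X j : MvPolynomial (Fin N) ℂ) ≠ 0 :=
    sub_ne_zero.mpr fun e => hij (X_injective e)
  exact mul_left_cancel₀ hne ((sub_mul_divDiff i j f).trans h.symm)

/-- The Dunkl operator `D_i f = ∂f/∂x_i + κ ∑_{j ≠ i} (f - (i, j) f) / (x_i - x_j)`. -/
def dunkl {N : ℕ} (κ : ℂ) (i : Fin N) (f : MvPolynomial (Fin N) ℂ) : MvPolynomial (Fin N) ℂ :=
  pderiv i f + C κ * ∑ j ∈ Finset.univ.erase i, divDiff i j f

/-- The formal power series `(1 - u x_i) ^ a` in one of the two variables `u` (number `v`, where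
`s` is number `0` and `t` is number `1`): substitute `-u x_i` in the binomial series
`(1 + z) ^ a`. -/
def oneSubPow {N : ℕ} (v : Fin 2) (i : Fin N) (a : ℂ) :
    MvPowerSeries (Fin 2) (MvPolynomial (Fin N) ℂ) :=
  PowerSeries.toMvPowerSeries v
    (PowerSeries.rescale (-X i) (PowerSeries.binomialSeries (MvPolynomial (Fin N) ℂ) a))

/-- The index of the variable `x_1`. -/
def idx₁ {N : ℕ} (hN : 2 ≤ N) : Fin N := ⟨0, by omega⟩

/-- The index of the variable `x_2`. -/
def idx₂ {N : ℕ} (hN : 2 ≤ N) : Fin N := ⟨1, by omega⟩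

/-- The generating function
`(1 - s x_1)⁻¹ (1 - t x_2)⁻¹ ∏_i ((1 - s x_i) (1 - t x_i)) ^ (-κ)`. -/
def genFun {N : ℕ} (hN : 2 ≤ N) (κ : ℂ) : MvPowerSeries (Fin 2) (MvPolynomial (Fin N) ℂ) :=
  oneSubPow 0 (idx₁ hN) (-1) * oneSubPow 1 (idx₂ hN) (-1) *
    ∏ i : Fin N, (oneSubPow 0 i (-κ) * oneSubPow 1 i (-κ))

/-- `p_{mn}`, the coefficient of `s ^ m t ^ n` in the generating function. -/
def p {N : ℕ} (hN : 2 ≤ N) (κ : ℂ) (m n : ℕ) : MvPolynomial (Fin N) ℂ :=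
  MvPowerSeries.coeff (Finsupp.single 0 m + Finsupp.single 1 n) (genFun hN κ)

/-- The Pochhammer symbol `(a)_n = a (a + 1) ⋯ (a + n - 1)`. -/
def poch (a : ℂ) (n : ℕ) : ℂ := (ascPochhammer ℂ n).eval a

/-- The formula for `ω_{mn}` when `m ≥ n`. -/
def omegaGe {N : ℕ} (hN : 2 ≤ N) (κ : ℂ) (m n : ℕ) : MvPolynomial (Fin N) ℂ :=
  p hN κ m n + ∑ j ∈ Finset.Icc 1 n,
    C (poch (-κ) j * poch ((m : ℂ) - n + 1) (j - 1) /
        (poch (κ + m - n + 1) j * (j.factorial : ℂ))) *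
      (C ((m : ℂ) - n + j) * p hN κ (m + j) (n - j) + C (j : ℂ) * p hN κ (n - j) (m + j))

/-- `ω_{mn}` for all integers `m`, `n`: the formula above for `m ≥ n ≥ 0`, its image under the
transposition `(1, 2)` with the labels exchanged for `n > m ≥ 0`, and zero when a label is
negative. -/
def omega {N : ℕ} (hN : 2 ≤ N) (κ : ℂ) (m n : ℤ) : MvPolynomial (Fin N) ℂ :=
  if m < 0 ∨ n < 0 then 0
  else if n ≤ m then omegaGe hN κ m.toNat n.toNat
  else transp (idx₁ hN) (idx₂ hN) (omegaGe hN κ n.toNat m.toNat)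

end

end SymJack

namespace SymJack

noncomputable section

open MvPolynomial

/-! The generating function splits into a series in `s` times a series in `t`, so `p_{mn} = q_{1,m}
q_{2,n}`, where `q_{i,m}` (`simpleCoeff`) is the coefficient of `u ^ m` in `(1 - u x_i)⁻¹ ∏ k, (1 -
u x_k) ^ (-κ)`.

On such a product a Dunkl operator is almost a lowering operator: `D_i (q_{i,m} q_{j,n})` is `(N κ +
m) q_{i,m-1} q_{j,n}`, by Euler's relation `euler_simpleCoeff`, plus `κ` times an error `E(m,n)`
(`dunkl_simpleCoeff_mul`). The error is symmetric in `m, n`, vanishes when either is `0`, and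
`E(m,n+1) - E(m+1,n)` is the antisymmetrization of `q_{i,m} q_{j,n}` (`exchangeTerm_sub`).

In `D ω_{mn}` all errors therefore lie on one antidiagonal, and `p_{m+k,n-k}` and `p_{n-k,m+k}`
contribute the same one. Summation by parts turns them into products `q q`, with coefficients the
partial sums of `weight + coweight`, which have a closed form (`sum_weight_add_coweight`). Comparing
coefficients leaves the Pochhammer identities `weight_right_relation`, `coweight_right_relation`,
`weight_left_relation` and `coweight_left_relation`, which rest on the contiguous relations
`weight_eq` and `coweight_succ_eq`. The third formula is the second one with `x_1, x_2` exchanged,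
since `ω_{nn}` is symmetric in them. -/

/-! ### Derivations and coefficients of power series. -/

/-- If `D (T i) = c i * T i` for each factor, then `D` multiplies the product by `∑ c i`. -/
theorem derivation_prod_of_eq_mul {A S ι : Type*} [CommSemiring A] [CommRing S] [Algebra A S]
    (D : Derivation A S S) (s : Finset ι) (T c : ι → S) (h : ∀ i ∈ s, D (T i) = c i * T i) :
    D (∏ i ∈ s, T i) = (∑ i ∈ s, c i) * ∏ i ∈ s, T i := by
  classical
  induction s using Finset.induction_on with
  | empty => simp
  | insert a s ha ih =>
    rw [Finset.prod_insert ha, Finset.sum_insert ha, Derivation.leibniz,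
      ih fun i hi => h i (Finset.mem_insert_of_mem hi), h a (Finset.mem_insert_self a s)]
    simp only [smul_eq_mul]
    ring

theorem succ_mul_choose_succ (a : ℂ) (k : ℕ) :
    ((k : ℂ) + 1) * Ring.choose a (k + 1) = a * Ring.choose (a - 1) k := by
  have h := Ring.choose_smul_choose a (n := k + 1) (k := 1) (by omega)
  simpa using h

theorem coeff_toMvPowerSeries_single {R σ : Type*} [CommSemiring R] (v : σ) (f : PowerSeries R)
    (k : ℕ) :
    MvPowerSeries.coeff (Finsupp.single v k) (PowerSeries.toMvPowerSeries v f) =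
      PowerSeries.coeff k f := by
  have h := MvPowerSeries.coeff_embDomain_rename (Function.Embedding.punit v) f
    (Finsupp.single PUnit.unit k)
  rw [Finsupp.embDomain_single] at h
  exact h

theorem coeff_toMvPowerSeries_of_ne {R σ : Type*} [CommSemiring R] {v w : σ} (f : PowerSeries R)
    {d : σ →₀ ℕ} (hvw : w ≠ v) (hd : d w ≠ 0) :
    MvPowerSeries.coeff d (PowerSeries.toMvPowerSeries v f) = 0 := by
  refine MvPowerSeries.coeff_rename_eq_zero _ _ ?_
  rintro ⟨y, rfl⟩
  refine hd (Finsupp.mapDomain_of_notMem_range _ _ ?_)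
  rintro ⟨_, h⟩
  exact hvw h.symm

/-- The coefficients of a product of a series in `s` and a series in `t`. -/
theorem coeff_toMvPowerSeries_mul {R : Type*} [CommSemiring R] (f g : PowerSeries R) (m n : ℕ) :
    MvPowerSeries.coeff (Finsupp.single (0 : Fin 2) m + Finsupp.single 1 n)
        (PowerSeries.toMvPowerSeries 0 f * PowerSeries.toMvPowerSeries 1 g) =
      PowerSeries.coeff m f * PowerSeries.coeff n g := by
  rw [MvPowerSeries.coeff_mul, Finset.sum_eq_single (Finsupp.single 0 m, Finsupp.single 1 n)]
  · rw [coeff_toMvPowerSeries_single, coeff_toMvPowerSeries_single]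
  · rintro ⟨d, e⟩ hde hne
    rw [Finset.HasAntidiagonal.mem_antidiagonal] at hde
    by_cases h1 : d 1 = 0
    · by_cases h0 : e 0 = 0
      · exfalso
        apply hne
        have e0 := DFunLike.congr_fun hde 0
        have e1 := DFunLike.congr_fun hde 1
        simp [h0, h1] at e0 e1
        refine Prod.ext ?_ ?_ <;> ext i <;> fin_cases i <;> simp [*]
      · rw [coeff_toMvPowerSeries_of_ne g (w := 0) (by decide) h0, mul_zero]
    · rw [coeff_toMvPowerSeries_of_ne f (w := 1) (by decide) h1, zero_mul]
  · intro h
    simp at h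

/-- Coefficientwise application of a derivation to power series. -/
def mapDerivation {A R : Type*} [CommSemiring A] [CommRing R] [Algebra A R]
    (D : Derivation A R R) : Derivation A (PowerSeries R) (PowerSeries R) :=
  Derivation.mk'
    { toFun := fun f => PowerSeries.mk fun n => D (PowerSeries.coeff n f)
      map_add' := fun f g => by ext n; simp
      map_smul' := fun a f => by ext n; simp }
    (fun f g => by
      ext n
      simp only [LinearMap.coe_mk, AddHom.coe_mk, PowerSeries.coeff_mk, smul_eq_mul, map_add,
        PowerSeries.coeff_mul, map_sum, Derivation.leibniz, Finset.sum_add_distrib]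
      congr 1
      rw [← Finset.Nat.sum_antidiagonal_swap]
      rfl)

@[simp]
theorem coeff_mapDerivation {A R : Type*} [CommSemiring A] [CommRing R] [Algebra A R]
    (D : Derivation A R R) (f : PowerSeries R) (n : ℕ) :
    PowerSeries.coeff n (mapDerivation D f) = D (PowerSeries.coeff n f) := by
  simp [mapDerivation]

/-! ### The series `(1 - u x_i) ^ a` and its derivatives. -/

variable {N : ℕ}

/-- The power series `(1 - u x_i) ^ a` in one variable `u`. -/
def powSeries (i : Fin N) (a : ℂ) : PowerSeries (MvPolynomial (Fin N) ℂ) :=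
  PowerSeries.rescale (-X i) (PowerSeries.binomialSeries (MvPolynomial (Fin N) ℂ) a)

theorem coeff_powSeries (i : Fin N) (a : ℂ) (n : ℕ) :
    PowerSeries.coeff n (powSeries i a) = (-X i) ^ n * C (Ring.choose a n) := by
  rw [powSeries, PowerSeries.coeff_rescale, PowerSeries.binomialSeries_coeff, smul_eq_C_mul,
    mul_one]

theorem powSeries_add (i : Fin N) (a b : ℂ) :
    powSeries i (a + b) = powSeries i a * powSeries i b := by
  rw [powSeries, PowerSeries.binomialSeries_add, map_mul]
  rfl

theorem powSeries_zero (i : Fin N) : powSeries i 0 = 1 := by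
  rw [powSeries, PowerSeries.binomialSeries_zero, map_one]

theorem powSeries_one (i : Fin N) :
    powSeries i 1 = 1 - PowerSeries.C (X i) * PowerSeries.X := by
  have h := PowerSeries.binomialSeries_nat (R := ℂ) (A := MvPolynomial (Fin N) ℂ) 1
  rw [Nat.cast_one, pow_one] at h
  rw [powSeries, h, map_add, map_one, PowerSeries.rescale_X, map_neg]
  ring

theorem X_mul_powSeries_neg_one (i : Fin N) :
    PowerSeries.X * PowerSeries.C (X i) * powSeries i (-1) = powSeries i (-1) - 1 := by
  have h := powSeries_add i 1 (-1)
  rw [add_neg_cancel, powSeries_zero, powSeries_one] at h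
  linear_combination h

theorem map_rename_powSeries (σ : Equiv.Perm (Fin N)) (i : Fin N) (a : ℂ) :
    PowerSeries.map (rename σ : _ →ₐ[ℂ] MvPolynomial (Fin N) ℂ).toRingHom (powSeries i a) =
      powSeries (σ i) a := by
  ext1 n
  simp [coeff_powSeries]

theorem derivative_powSeries (i : Fin N) (a : ℂ) :
    PowerSeries.derivative (R := MvPolynomial (Fin N) ℂ) (powSeries i a) =
      PowerSeries.C (C (-a) * X i) * powSeries i (-1) * powSeries i a := by
  rw [mul_assoc, ← powSeries_add]
  ext1 n
  have h := congrArg (C (σ := Fin N)) (succ_mul_choose_succ a n)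
  rw [show a - 1 = -1 + a by ring] at h
  simp only [map_mul, map_add, map_one, map_natCast] at h
  rw [PowerSeries.coeff_derivative, PowerSeries.coeff_C_mul, coeff_powSeries, coeff_powSeries,
    pow_succ, map_neg]
  linear_combination (-(X i) * (-X i) ^ n) * h

theorem mapDerivation_pderiv_powSeries_self (i : Fin N) (a : ℂ) :
    mapDerivation (pderiv i) (powSeries i a) =
      PowerSeries.C (C (-a)) * PowerSeries.X * powSeries i (-1) * powSeries i a := by
  rw [mul_assoc, ← powSeries_add, mul_assoc]
  ext1 n
  rw [coeff_mapDerivation, PowerSeries.coeff_C_mul, coeff_powSeries]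
  cases n with
  | zero => simp
  | succ n =>
    have h := congrArg (C (σ := Fin N)) (succ_mul_choose_succ a n)
    rw [show a - 1 = -1 + a by ring] at h
    simp only [map_mul, map_add, map_one, map_natCast] at h
    rw [PowerSeries.coeff_succ_X_mul, coeff_powSeries, Derivation.leibniz, pderiv_C,
      Derivation.leibniz_pow, map_neg, pderiv_X_self, map_neg]
    simp only [smul_eq_mul, nsmul_eq_mul, Nat.add_sub_cancel]
    push_cast
    linear_combination (-(-X i) ^ n) * h

theorem mapDerivation_pderiv_powSeries_of_ne {i j : Fin N} (h : j ≠ i) (a : ℂ) :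
    mapDerivation (pderiv i) (powSeries j a) = 0 := by
  ext1 n
  rw [coeff_mapDerivation, coeff_powSeries, Derivation.leibniz, pderiv_C, Derivation.leibniz_pow,
    map_neg, pderiv_X_of_ne h]
  simp

/-! ### Coefficients of the one-variable generating series. -/

/-- The symmetric power series `∏ i, (1 - u x_i) ^ (-κ)`. -/
def symSeries (N : ℕ) (κ : ℂ) : PowerSeries (MvPolynomial (Fin N) ℂ) :=
  ∏ i : Fin N, powSeries i (-κ)

theorem map_rename_symSeries (σ : Equiv.Perm (Fin N)) (κ : ℂ) :
    PowerSeries.map (rename σ : _ →ₐ[ℂ] MvPolynomial (Fin N) ℂ).toRingHom (symSeries N κ) =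
      symSeries N κ := by
  rw [symSeries, map_prod, ← Equiv.prod_comp σ fun i => powSeries i (-κ)]
  exact Finset.prod_congr rfl fun i _ => map_rename_powSeries σ i _

theorem derivative_symSeries (κ : ℂ) :
    PowerSeries.derivative (R := MvPolynomial (Fin N) ℂ) (symSeries N κ) =
      (∑ i, PowerSeries.C (C κ * X i) * powSeries i (-1)) * symSeries N κ := by
  refine derivation_prod_of_eq_mul _ _ _ _ fun i _ => ?_
  rw [derivative_powSeries, neg_neg]

theorem mapDerivation_pderiv_symSeries (i : Fin N) (κ : ℂ) :
    mapDerivation (pderiv i) (symSeries N κ) =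
      PowerSeries.C (C κ) * PowerSeries.X * powSeries i (-1) * symSeries N κ := by
  have h := derivation_prod_of_eq_mul (mapDerivation (pderiv i)) Finset.univ
    (fun j => powSeries j (-κ)) (fun j => if j = i then
      PowerSeries.C (C κ) * PowerSeries.X * powSeries i (-1) else 0) (fun j _ => by
        split_ifs with hj
        · subst hj
          rw [mapDerivation_pderiv_powSeries_self, neg_neg]
        · rw [mapDerivation_pderiv_powSeries_of_ne hj, zero_mul])
  rw [Finset.sum_ite_eq' Finset.univ i, if_pos (Finset.mem_univ i)] at h
  exact h

/-- The coefficient of `u ^ n` in `(1 - u x_i)⁻¹ ∏ k, (1 - u x_k) ^ (-κ)`. -/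
def simpleCoeff (κ : ℂ) (i : Fin N) (n : ℕ) : MvPolynomial (Fin N) ℂ :=
  PowerSeries.coeff n (powSeries i (-1) * symSeries N κ)

/-- The coefficient of `u ^ n` in `u (1 - u x_i)⁻¹ (1 - u x_j)⁻¹ ∏ k, (1 - u x_k) ^ (-κ)`. -/
def doubleCoeff (κ : ℂ) (i j : Fin N) (n : ℕ) : MvPolynomial (Fin N) ℂ :=
  PowerSeries.coeff n
    (PowerSeries.X * (powSeries i (-1) * powSeries j (-1) * symSeries N κ))

theorem doubleCoeff_zero (κ : ℂ) (i j : Fin N) : doubleCoeff κ i j 0 = 0 := by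
  simp [doubleCoeff]

theorem doubleCoeff_comm (κ : ℂ) (i j : Fin N) (n : ℕ) :
    doubleCoeff κ i j n = doubleCoeff κ j i n := by
  rw [doubleCoeff, doubleCoeff, mul_comm (powSeries i (-1))]

/-- Multiplication by `1 - u x_j` removes the extra factor `(1 - u x_j)⁻¹`. Once everything is
written in `doubleCoeff`, which is symmetric in `i, j`, the divided-difference identities become
polynomial identities. -/
theorem simpleCoeff_eq (κ : ℂ) (i j : Fin N) (n : ℕ) :
    simpleCoeff κ i n = doubleCoeff κ i j (n + 1) - X j * doubleCoeff κ i j n := by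
  have h : powSeries i (-1) * symSeries N κ =
      powSeries i (-1) * powSeries j (-1) * symSeries N κ - PowerSeries.C (X j) *
        (PowerSeries.X * (powSeries i (-1) * powSeries j (-1) * symSeries N κ)) := by
    linear_combination (powSeries i (-1) * symSeries N κ) * X_mul_powSeries_neg_one j
  rw [simpleCoeff, h, map_sub, PowerSeries.coeff_C_mul, doubleCoeff, doubleCoeff,
    PowerSeries.coeff_succ_X_mul]

theorem transp_simpleCoeff (i j k : Fin N) (κ : ℂ) (n : ℕ) :
    transp i j (simpleCoeff κ k n) = simpleCoeff κ (Equiv.swap i j k) n := by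
  have h := PowerSeries.coeff_map
    (rename (Equiv.swap i j) : _ →ₐ[ℂ] MvPolynomial (Fin N) ℂ).toRingHom n
    (powSeries k (-1) * symSeries N κ)
  rw [map_mul, map_rename_powSeries, map_rename_symSeries] at h
  exact h.symm

theorem pderiv_simpleCoeff_self (i : Fin N) (κ : ℂ) (n : ℕ) :
    pderiv i (simpleCoeff κ i n) = C (1 + κ) * doubleCoeff κ i i n := by
  rw [simpleCoeff, ← coeff_mapDerivation, Derivation.leibniz, mapDerivation_pderiv_symSeries,
    mapDerivation_pderiv_powSeries_self, doubleCoeff, ← PowerSeries.coeff_C_mul]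
  congr 1
  simp only [smul_eq_mul, neg_neg, map_one, map_add]
  ring

theorem pderiv_simpleCoeff_of_ne {i j : Fin N} (h : j ≠ i) (κ : ℂ) (n : ℕ) :
    pderiv i (simpleCoeff κ j n) = C κ * doubleCoeff κ i j n := by
  rw [simpleCoeff, ← coeff_mapDerivation, Derivation.leibniz, mapDerivation_pderiv_symSeries,
    mapDerivation_pderiv_powSeries_of_ne h, doubleCoeff, ← PowerSeries.coeff_C_mul]
  congr 1
  simp only [smul_eq_mul]
  ring

/-- Euler's homogeneity relation for `simpleCoeff`. -/
theorem euler_simpleCoeff (i : Fin N) (κ : ℂ) (n : ℕ) :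
    C (N * κ + n + 1) * simpleCoeff κ i n =
      doubleCoeff κ i i (n + 1) + C κ * ∑ j, doubleCoeff κ i j (n + 1) := by
  set A := powSeries i (-1) * symSeries N κ with hA
  have hd : PowerSeries.derivative (R := MvPolynomial (Fin N) ℂ) A =
      PowerSeries.C (X i) * powSeries i (-1) * A +
        ∑ j, PowerSeries.C (C κ * X j) * powSeries j (-1) * A := by
    rw [hA, Derivation.leibniz, derivative_symSeries, derivative_powSeries, ← Finset.sum_mul]
    simp only [smul_eq_mul, neg_neg, map_one, one_mul]
    ring
  -- Each `u x (1 - u x)⁻¹` equals `(1 - u x)⁻¹ - 1`; the constant `N κ + 1` collects the `-1`s, `N`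
  -- of them with weight `κ` and one with weight `1`.
  have hs : PowerSeries.X * PowerSeries.derivative (R := MvPolynomial (Fin N) ℂ) A +
      PowerSeries.C (C (N * κ + 1)) * A = powSeries i (-1) * A +
        PowerSeries.C (C κ) * ∑ j, powSeries j (-1) * A := by
    have hj : ∀ j, PowerSeries.X * (PowerSeries.C (C κ * X j) * powSeries j (-1) * A) =
        PowerSeries.C (C κ) * (powSeries j (-1) * A) - PowerSeries.C (C κ) * A := fun j => by
      rw [map_mul]
      linear_combination (PowerSeries.C (C κ) * A) * X_mul_powSeries_neg_one j
    rw [hd, mul_add, Finset.mul_sum, Finset.sum_congr rfl fun j _ => hj j,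
      Finset.sum_sub_distrib, ← Finset.mul_sum, Finset.sum_const, Finset.card_univ,
      Fintype.card_fin, nsmul_eq_mul]
    simp only [map_add, map_mul, map_natCast, map_one]
    linear_combination A * X_mul_powSeries_neg_one i
  have hc := congrArg (PowerSeries.coeff n) hs
  have hX : PowerSeries.coeff n
      (PowerSeries.X * PowerSeries.derivative (R := MvPolynomial (Fin N) ℂ) A) =
        n * PowerSeries.coeff n A := by
    cases n with
    | zero => simp
    | succ n =>
      rw [PowerSeries.coeff_succ_X_mul, PowerSeries.coeff_derivative]
      push_cast
      ring
  rw [map_add, hX, PowerSeries.coeff_C_mul, map_add (PowerSeries.coeff n),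
    PowerSeries.coeff_C_mul, map_sum] at hc
  have hr : ∀ j, doubleCoeff κ i j (n + 1) = PowerSeries.coeff n (powSeries j (-1) * A) :=
    fun j => by
      rw [doubleCoeff, PowerSeries.coeff_succ_X_mul, hA]
      congr 1
      ring
  simp only [hr]
  rw [← hc, simpleCoeff, ← hA]
  simp only [map_add, map_mul, map_natCast, map_one]
  ring

theorem p_eq (hN : 2 ≤ N) (κ : ℂ) (m n : ℕ) :
    p hN κ m n = simpleCoeff κ (idx₁ hN) m * simpleCoeff κ (idx₂ hN) n := by
  have h : genFun hN κ =
      PowerSeries.toMvPowerSeries 0 (powSeries (idx₁ hN) (-1) * symSeries N κ) *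
        PowerSeries.toMvPowerSeries 1 (powSeries (idx₂ hN) (-1) * symSeries N κ) := by
    rw [genFun, Finset.prod_mul_distrib, map_mul, map_mul, symSeries, map_prod, map_prod]
    simp only [oneSubPow, powSeries]
    ring
  rw [p, h, coeff_toMvPowerSeries_mul]
  rfl

/-! ### Dunkl operators on products of two coefficients. -/

theorem divDiff_add {i j : Fin N} (h : i ≠ j) (f g : MvPolynomial (Fin N) ℂ) :
    divDiff i j (f + g) = divDiff i j f + divDiff i j g := by
  refine divDiff_eq h ?_
  rw [mul_add, sub_mul_divDiff, sub_mul_divDiff]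
  simp only [transp, map_add]
  ring

theorem divDiff_mul_of_transp_eq {i j : Fin N} (h : i ≠ j) (f : MvPolynomial (Fin N) ℂ)
    {g : MvPolynomial (Fin N) ℂ} (hg : transp i j g = g) :
    divDiff i j (f * g) = divDiff i j f * g := by
  refine divDiff_eq h ?_
  rw [← mul_assoc, sub_mul_divDiff]
  simp only [transp, map_mul] at hg ⊢
  rw [hg]
  ring

theorem dunkl_add (κ : ℂ) (i : Fin N) (f g : MvPolynomial (Fin N) ℂ) :
    dunkl κ i (f + g) = dunkl κ i f + dunkl κ i g := by
  simp only [dunkl]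
  rw [Finset.sum_congr rfl fun j hj => divDiff_add (Finset.ne_of_mem_erase hj).symm f g,
    Finset.sum_add_distrib, map_add]
  ring

theorem dunkl_C_mul (κ : ℂ) (i : Fin N) (c : ℂ) (f : MvPolynomial (Fin N) ℂ) :
    dunkl κ i (C c * f) = C c * dunkl κ i f := by
  simp only [dunkl]
  rw [mul_comm (C c) f, Finset.sum_congr rfl fun j hj =>
    divDiff_mul_of_transp_eq (Finset.ne_of_mem_erase hj).symm f
      (g := C c) (by simp [transp]), ← Finset.sum_mul, Derivation.leibniz, pderiv_C]
  simp only [smul_eq_mul]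
  ring

/-- The Dunkl operator as a linear map. -/
def dunklHom (κ : ℂ) (i : Fin N) : MvPolynomial (Fin N) ℂ →ₗ[ℂ] MvPolynomial (Fin N) ℂ where
  toFun := dunkl κ i
  map_add' := dunkl_add κ i
  map_smul' c f := by simp only [smul_eq_C_mul, dunkl_C_mul, RingHom.id_apply]

theorem dunkl_sum {ι : Type*} (κ : ℂ) (i : Fin N) (s : Finset ι)
    (f : ι → MvPolynomial (Fin N) ℂ) :
    dunkl κ i (∑ k ∈ s, f k) = ∑ k ∈ s, dunkl κ i (f k) :=
  map_sum (dunklHom κ i) f s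

/-- The polynomial by which `dunkl κ i` of a product of two `simpleCoeff` fails to be a multiple
of such a product; it is the coefficient of `s ^ m t ^ n` in `s t (F - (i, j) F) / (s - t)`. -/
def exchangeTerm (κ : ℂ) (i j : Fin N) (m n : ℕ) : MvPolynomial (Fin N) ℂ :=
  (X i - X j) * (doubleCoeff κ i j m * doubleCoeff κ i j n)

theorem exchangeTerm_zero_right (κ : ℂ) (i j : Fin N) (m : ℕ) : exchangeTerm κ i j m 0 = 0 := by
  rw [exchangeTerm, doubleCoeff_zero, mul_zero, mul_zero]

theorem exchangeTerm_comm (κ : ℂ) (i j : Fin N) (m n : ℕ) :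
    exchangeTerm κ i j m n = exchangeTerm κ i j n m := by
  rw [exchangeTerm, exchangeTerm, mul_comm (doubleCoeff κ i j m)]

theorem exchangeTerm_swap (κ : ℂ) (i j : Fin N) (m n : ℕ) :
    exchangeTerm κ j i m n = -exchangeTerm κ i j m n := by
  rw [exchangeTerm, exchangeTerm, doubleCoeff_comm κ j i, doubleCoeff_comm κ j i]
  ring

theorem exchangeTerm_sub (κ : ℂ) (i j : Fin N) (m n : ℕ) :
    exchangeTerm κ i j m (n + 1) - exchangeTerm κ i j (m + 1) n =
      simpleCoeff κ i m * simpleCoeff κ j n - simpleCoeff κ i n * simpleCoeff κ j m := by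
  rw [exchangeTerm, exchangeTerm, simpleCoeff_eq κ i j, simpleCoeff_eq κ i j,
    simpleCoeff_eq κ j i, simpleCoeff_eq κ j i]
  simp only [doubleCoeff_comm κ j i]
  ring

theorem divDiff_simpleCoeff {i j : Fin N} (h : i ≠ j) (κ : ℂ) (n : ℕ) :
    divDiff i j (simpleCoeff κ i n) = doubleCoeff κ i j n := by
  refine divDiff_eq h ?_
  rw [transp_simpleCoeff, Equiv.swap_apply_left, simpleCoeff_eq κ i j, simpleCoeff_eq κ j i]
  simp only [doubleCoeff_comm κ j i]
  ring

theorem divDiff_simpleCoeff_mul {i j : Fin N} (h : i ≠ j) (κ : ℂ) (m n : ℕ) :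
    divDiff i j (simpleCoeff κ i m * simpleCoeff κ j n) =
      doubleCoeff κ i j m * doubleCoeff κ i j (n + 1) -
        doubleCoeff κ i j (m + 1) * doubleCoeff κ i j n := by
  refine divDiff_eq h ?_
  have ht : transp i j (simpleCoeff κ i m * simpleCoeff κ j n) =
      simpleCoeff κ j m * simpleCoeff κ i n := by
    have h1 := transp_simpleCoeff i j i κ m
    have h2 := transp_simpleCoeff i j j κ n
    rw [Equiv.swap_apply_left] at h1
    rw [Equiv.swap_apply_right] at h2
    rw [← h1, ← h2]
    simp only [transp, map_mul]
  rw [ht, simpleCoeff_eq κ i j, simpleCoeff_eq κ i j, simpleCoeff_eq κ j i, simpleCoeff_eq κ j i]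
  simp only [doubleCoeff_comm κ j i]
  ring

/-- For `k ≠ i, j` the factor with index `j` is fixed by `(i, k)` and passes through the divided
difference. The error comes only from `k = j`, where the divided difference combines with the
derivative of the second factor. -/
theorem dunkl_simpleCoeff_mul {i j : Fin N} (h : i ≠ j) (κ : ℂ) (m n : ℕ) :
    dunkl κ i (simpleCoeff κ i m * simpleCoeff κ j n) =
      (doubleCoeff κ i i m + C κ * ∑ k, doubleCoeff κ i k m) * simpleCoeff κ j n +
        C κ * exchangeTerm κ i j m n := by
  have hj : j ∈ Finset.univ.erase i := Finset.mem_erase.2 ⟨h.symm, Finset.mem_univ j⟩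
  have hk : ∀ k ∈ (Finset.univ.erase i).erase j,
      divDiff i k (simpleCoeff κ i m * simpleCoeff κ j n) =
        doubleCoeff κ i k m * simpleCoeff κ j n := fun k hk => by
    obtain ⟨hkj, hki⟩ := Finset.mem_erase.1 hk
    have hki := Finset.ne_of_mem_erase hki
    rw [divDiff_mul_of_transp_eq hki.symm, divDiff_simpleCoeff hki.symm]
    rw [transp_simpleCoeff, Equiv.swap_apply_of_ne_of_ne h.symm hkj.symm]
  rw [dunkl, ← Finset.add_sum_erase _ _ hj, Finset.sum_congr rfl hk, ← Finset.sum_mul,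
    divDiff_simpleCoeff_mul h, Derivation.leibniz, pderiv_simpleCoeff_self,
    pderiv_simpleCoeff_of_ne h.symm, ← Finset.add_sum_erase _ _ (Finset.mem_univ i),
    ← Finset.add_sum_erase _ _ hj, exchangeTerm, simpleCoeff_eq κ i j m, simpleCoeff_eq κ j i n]
  simp only [doubleCoeff_comm κ j i, smul_eq_mul, map_add, map_one]
  ring

theorem dunkl_simpleCoeff_succ_mul {i j : Fin N} (h : i ≠ j) (κ : ℂ) (m n : ℕ) :
    dunkl κ i (simpleCoeff κ i (m + 1) * simpleCoeff κ j n) =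
      C (N * κ + m + 1) * (simpleCoeff κ i m * simpleCoeff κ j n) +
        C κ * exchangeTerm κ i j (m + 1) n := by
  rw [dunkl_simpleCoeff_mul h, ← euler_simpleCoeff, mul_assoc]

theorem dunkl_simpleCoeff_zero_mul {i j : Fin N} (h : i ≠ j) (κ : ℂ) (n : ℕ) :
    dunkl κ i (simpleCoeff κ i 0 * simpleCoeff κ j n) = 0 := by
  rw [dunkl_simpleCoeff_mul h, exchangeTerm_comm, exchangeTerm_zero_right]
  simp [doubleCoeff_zero]

theorem dunkl_mul_simpleCoeff_succ {i j : Fin N} (h : i ≠ j) (κ : ℂ) (m n : ℕ) :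
    dunkl κ j (simpleCoeff κ i m * simpleCoeff κ j (n + 1)) =
      C (N * κ + n + 1) * (simpleCoeff κ i m * simpleCoeff κ j n) -
        C κ * exchangeTerm κ i j m (n + 1) := by
  rw [mul_comm (simpleCoeff κ i m), dunkl_simpleCoeff_succ_mul h.symm, exchangeTerm_swap,
    exchangeTerm_comm]
  ring

theorem dunkl_mul_simpleCoeff_zero {i j : Fin N} (h : i ≠ j) (κ : ℂ) (m : ℕ) :
    dunkl κ j (simpleCoeff κ i m * simpleCoeff κ j 0) = 0 := by
  rw [mul_comm, dunkl_simpleCoeff_zero_mul h.symm]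

/-! ### Pochhammer weights and their contiguous relations. -/

theorem poch_zero (a : ℂ) : poch a 0 = 1 := by simp [poch]

theorem poch_succ (a : ℂ) (k : ℕ) : poch a (k + 1) = poch a k * (a + k) :=
  ascPochhammer_succ_eval k a

theorem poch_succ_left (a : ℂ) (k : ℕ) : poch a (k + 1) = a * poch (a + 1) k := by
  simp [poch, ascPochhammer_succ_left]

theorem poch_ne_zero {a : ℂ} (h : ∀ k : ℕ, a + k ≠ 0) (n : ℕ) : poch a n ≠ 0 := by
  induction n with
  | zero => simp [poch_zero]
  | succ n ih => rw [poch_succ]; exact mul_ne_zero ih (h n)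

/-- The coefficient of `p (m + k) (n - k)` in `ω m n`, where `d = m - n`. -/
def weight (κ d : ℂ) (k : ℕ) : ℂ :=
  poch (-κ) k * poch (d + 1) k / (poch (κ + d + 1) k * k.factorial)

/-- The coefficient of `p (n - k) (m + k)` in `ω m n`, where `d = m - n`. -/
def coweight (κ d : ℂ) (k : ℕ) : ℂ :=
  poch (-κ) k * poch (d + 1) (k - 1) * k / (poch (κ + d + 1) k * k.factorial)

/-- The closed form of the partial sums of `weight + coweight`. -/
def weightSum (κ d : ℂ) (k : ℕ) : ℂ :=
  poch (1 - κ) k * poch (d + 1) k / (poch (κ + d + 1) k * k.factorial)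

theorem weight_zero (κ d : ℂ) : weight κ d 0 = 1 := by simp [weight, poch_zero]

theorem coweight_zero (κ d : ℂ) : coweight κ d 0 = 0 := by simp [coweight]

theorem poch_neg_succ (κ : ℂ) (k : ℕ) : poch (-κ) (k + 1) = -κ * poch (1 - κ) k := by
  rw [poch_succ_left, neg_add_eq_sub]

theorem weightSum_succ {κ d : ℂ} (h : ∀ k : ℕ, κ + d + 1 + k ≠ 0) (k : ℕ) :
    weightSum κ d (k + 1) =
      weightSum κ d k + (weight κ d (k + 1) + coweight κ d (k + 1)) := by
  have hp := poch_ne_zero h k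
  have hk := h k
  have hf : (k.factorial : ℂ) ≠ 0 := Nat.cast_ne_zero.2 k.factorial_ne_zero
  have hk1 : (k : ℂ) + 1 ≠ 0 := Nat.cast_add_one_ne_zero k
  simp only [weightSum, weight, coweight, poch_neg_succ, Nat.factorial_succ, Nat.add_sub_cancel]
  rw [poch_succ (1 - κ), poch_succ (d + 1), poch_succ (κ + d + 1)]
  push_cast
  field_simp
  ring

theorem sum_weight_add_coweight {κ d : ℂ} (h : ∀ k : ℕ, κ + d + 1 + k ≠ 0) (n : ℕ) :
    ∑ k ∈ Finset.range (n + 1), (weight κ d k + coweight κ d k) = weightSum κ d n := by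
  induction n with
  | zero => simp [weight_zero, coweight_zero, weightSum, poch_zero]
  | succ n ih => rw [Finset.sum_range_succ, ih, weightSum_succ h]

/-- This and `coweight_succ_mul` tie the partial sums to single weights, so that the summed errors
can cancel the `k`-dependence of the Euler factors. -/
theorem weight_mul_sub (κ d : ℂ) (k : ℕ) :
    weight κ d k * (κ - k) = κ * weightSum κ d k := by
  have h := (poch_succ (-κ) k).symm.trans (poch_neg_succ κ k)
  rw [weight, weightSum]
  linear_combination (-poch (d + 1) k / (poch (κ + d + 1) k * k.factorial)) * h

theorem coweight_succ_mul {κ d : ℂ} (h : ∀ k : ℕ, κ + d + 1 + k ≠ 0) (k : ℕ) :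
    coweight κ d (k + 1) * (κ + d + 1 + k) = -κ * weightSum κ d k := by
  have hp := poch_ne_zero h k
  have hk := h k
  have hf : (k.factorial : ℂ) ≠ 0 := Nat.cast_ne_zero.2 k.factorial_ne_zero
  have hk1 : (k : ℂ) + 1 ≠ 0 := Nat.cast_add_one_ne_zero k
  simp only [weightSum, coweight, poch_neg_succ, Nat.factorial_succ, Nat.add_sub_cancel]
  rw [poch_succ (κ + d + 1)]
  push_cast
  field_simp

theorem add_mul_coweight (κ d : ℂ) (k : ℕ) :
    (d + k) * coweight κ d k = k * weight κ d k := by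
  cases k with
  | zero => simp [coweight_zero]
  | succ k =>
    simp only [weight, coweight, Nat.add_sub_cancel]
    rw [poch_succ (d + 1)]
    push_cast
    ring

/-- With `coweight_succ_eq`, this says that the combination of the two `ω`s of label difference `d +
1` on the right of the formula for `D_2` has, up to an index shift, the weights for `d` as
coefficients. -/
theorem weight_eq {κ d : ℂ} (h : ∀ k : ℕ, κ + d + 1 + k ≠ 0) (k : ℕ) :
    weight κ d k = weight κ (d + 1) k - κ / (κ + d + 1) * coweight κ (d + 1) k := by
  cases k with
  | zero => simp [weight_zero, coweight_zero]
  | succ k =>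
    have h' : ∀ k : ℕ, κ + d + 1 + 1 + k ≠ 0 := fun k => by
      have := h (k + 1)
      push_cast at this
      convert this using 1
      ring
    have h0 : κ + d + 1 ≠ 0 := by simpa using h 0
    have hp := poch_ne_zero h' k
    have hk := h' k
    have hf : ((k + 1).factorial : ℂ) ≠ 0 := Nat.cast_ne_zero.2 (k + 1).factorial_ne_zero
    simp only [weight, coweight, Nat.add_sub_cancel]
    rw [show κ + (d + 1) + 1 = κ + d + 1 + 1 by ring, poch_succ_left (d + 1),
      poch_succ_left (κ + d + 1), poch_succ (d + 1 + 1), poch_succ (κ + d + 1 + 1)]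
    push_cast
    field_simp
    ring

theorem coweight_succ_eq {κ d : ℂ} (h : ∀ k : ℕ, κ + d + 1 + k ≠ 0) (k : ℕ) :
    coweight κ d (k + 1) = coweight κ (d + 1) k - κ / (κ + d + 1) * weight κ (d + 1) k := by
  have h0 : κ + d + 1 ≠ 0 := by simpa using h 0
  cases k with
  | zero =>
    simp [coweight, weight, poch_succ, poch_zero]
    ring
  | succ k =>
    have h' : ∀ k : ℕ, κ + d + 1 + 1 + k ≠ 0 := fun k => by
      have := h (k + 1)
      push_cast at this
      convert this using 1
      ring
    have hp := poch_ne_zero h' k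
    have hk := h' k
    have hf : ((k + 1).factorial : ℂ) ≠ 0 := Nat.cast_ne_zero.2 (k + 1).factorial_ne_zero
    have hk1 : (k : ℂ) + 1 + 1 ≠ 0 := by exact_mod_cast Nat.succ_ne_zero (k + 1)
    simp only [weight, coweight, Nat.add_sub_cancel, Nat.factorial_succ (k + 1)]
    rw [show κ + (d + 1) + 1 = κ + d + 1 + 1 by ring, poch_succ (-κ) (k + 1),
      poch_succ_left (d + 1), poch_succ_left (κ + d + 1), poch_succ (d + 1 + 1),
      poch_succ (κ + d + 1 + 1)]
    push_cast
    field_simp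
    ring

theorem weight_right_relation {κ d N n : ℂ} (h : ∀ k : ℕ, κ + d + 1 + k ≠ 0) (k : ℕ) :
    weight κ d k * (N * κ + (n - k) + 1) - κ * weightSum κ d k =
      ((N - 1) * κ + n + 1) *
        (weight κ (d + 1) k - κ / (κ + d + 1) * coweight κ (d + 1) k) := by
  rw [← weight_eq h, ← weight_mul_sub]
  ring

theorem coweight_right_relation {κ d N m n : ℂ} (hm : m = d + n + 1)
    (h : ∀ k : ℕ, κ + d + 1 + k ≠ 0) (k : ℕ) :
    coweight κ d (k + 1) * (N * κ + (m + k) + 1) + κ * weightSum κ d k =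
      ((N - 1) * κ + n + 1) *
        (coweight κ (d + 1) k - κ / (κ + d + 1) * weight κ (d + 1) k) := by
  rw [← coweight_succ_eq h, hm]
  linear_combination coweight_succ_mul h k

theorem add_one_add_ne_zero {κ d : ℂ} (h : ∀ k : ℕ, κ + d + k ≠ 0) (k : ℕ) :
    κ + d + 1 + k ≠ 0 := by
  have := h (k + 1)
  push_cast at this
  convert this using 1
  ring

theorem weight_left_relation {κ d N m n : ℂ} (hm : m = d + n) (h : ∀ k : ℕ, κ + d + k ≠ 0)
    (k : ℕ) :
    weight κ d (k + 1) * (N * κ + (m + (k + 1 : ℕ)) + 1) + κ * weightSum κ d k =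
      (N * κ + m + 1) * weight κ (d - 1) (k + 1) + ((N - 1) * κ + n + 1) * κ / (κ + d) *
        (coweight κ (d + 1) k - κ / (κ + d + 1) * weight κ (d + 1) k) := by
  have h0 : κ + d ≠ 0 := by simpa using h 0
  have h1 := add_one_add_ne_zero h
  have w := weight_eq (κ := κ) (d := d - 1) (fun k => by convert h k using 1; ring) (k + 1)
  rw [sub_add_cancel, show κ + (d - 1) + 1 = κ + d by ring] at w
  have s1 := weightSum_succ h1 k
  have s2 := weight_mul_sub κ d (k + 1)
  -- Since `m = d + n`, the factor `(N - 1) κ + n + 1` is `(N κ + m + 1) - (κ + d)`; the part with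
  -- denominator `κ + d` then cancels against `w`.
  have hN : ((N - 1) * κ + n + 1) * κ / (κ + d) = (N * κ + m + 1) * (κ / (κ + d)) - κ := by
    rw [hm]
    field_simp
    ring
  rw [← coweight_succ_eq h1, w, hN]
  linear_combination -s2 - κ * s1

theorem coweight_left_relation {κ d N m n : ℂ} (hm : m = d + n) (h : ∀ k : ℕ, κ + d + k ≠ 0)
    (k : ℕ) :
    coweight κ d k * (N * κ + (n - k) + 1) - κ * weightSum κ d k =
      (N * κ + m + 1) * coweight κ (d - 1) (k + 1) + ((N - 1) * κ + n + 1) * κ / (κ + d) *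
        (weight κ (d + 1) k - κ / (κ + d + 1) * coweight κ (d + 1) k) := by
  have h0 : κ + d ≠ 0 := by simpa using h 0
  have h1 := add_one_add_ne_zero h
  have w := coweight_succ_eq (κ := κ) (d := d - 1) (fun k => by convert h k using 1; ring) k
  rw [sub_add_cancel, show κ + (d - 1) + 1 = κ + d by ring] at w
  have s1 := weight_mul_sub κ d k
  have s2 := add_mul_coweight κ d k
  have hN : ((N - 1) * κ + n + 1) * κ / (κ + d) = (N * κ + m + 1) * (κ / (κ + d)) - κ := by
    rw [hm]
    field_simp
    ring
  rw [← weight_eq h1, w, hN, hm]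
  linear_combination s1 - s2

/-! ### Summation by parts. -/

/-- Summation by parts, for a sequence `Q` that vanishes at the last index. -/
theorem sum_mul_eq_sum_partial {R : Type*} [CommRing R] (w S Q : ℕ → R)
    (hS : ∀ n, ∑ k ∈ Finset.range (n + 1), w k = S n) (n : ℕ) (hQ : Q (n + 1) = 0) :
    ∑ k ∈ Finset.range (n + 2), w k * Q k =
      ∑ k ∈ Finset.range (n + 1), S k * (Q k - Q (k + 1)) := by
  have key : ∀ n, ∑ k ∈ Finset.range (n + 1), w k * Q k =
      ∑ k ∈ Finset.range n, S k * (Q k - Q (k + 1)) + S n * Q n := fun n => by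
    induction n with
    | zero => simp [← hS 0]
    | succ n ih =>
      have h1 : S (n + 1) = S n + w (n + 1) := by rw [← hS, ← hS, Finset.sum_range_succ _ (n + 1)]
      rw [Finset.sum_range_succ, ih, Finset.sum_range_succ _ n, h1]
      ring
  rw [key (n + 1), hQ, mul_zero, add_zero]

theorem sum_weight_mul {κ d : ℂ} (h : ∀ k : ℕ, κ + d + 1 + k ≠ 0)
    (Q : ℕ → MvPolynomial (Fin N) ℂ) (n : ℕ) (hQ : Q (n + 1) = 0) :
    ∑ k ∈ Finset.range (n + 2), (C (weight κ d k) + C (coweight κ d k)) * Q k =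
      ∑ k ∈ Finset.range (n + 1), C (weightSum κ d k) * (Q k - Q (k + 1)) := by
  refine sum_mul_eq_sum_partial _ _ _ (fun l => ?_) n hQ
  rw [← sum_weight_add_coweight h, map_sum]
  simp only [map_add]

/-! ### Dunkl operators on `ω`. -/

/-- The polynomial `ω m n` for `n ≤ m` with `x_1`, `x_2` replaced by `x_i`, `x_j`. -/
def omegaPair (κ : ℂ) (i j : Fin N) (m n : ℕ) : MvPolynomial (Fin N) ℂ :=
  ∑ k ∈ Finset.range (n + 1),
    (C (weight κ ((m : ℂ) - n) k) * (simpleCoeff κ i (m + k) * simpleCoeff κ j (n - k)) +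
      C (coweight κ ((m : ℂ) - n) k) * (simpleCoeff κ i (n - k) * simpleCoeff κ j (m + k)))

theorem omegaPair_zero_right (κ : ℂ) (i j : Fin N) (m : ℕ) :
    omegaPair κ i j m 0 = simpleCoeff κ i m * simpleCoeff κ j 0 := by
  simp [omegaPair, weight_zero, coweight_zero]

theorem weight_zero_left {κ : ℂ} {k : ℕ} (hk : k ≠ 0) : weight κ 0 k = coweight κ 0 k := by
  have h := add_mul_coweight κ 0 k
  rw [zero_add] at h
  exact (mul_left_cancel₀ (Nat.cast_ne_zero.2 hk) h).symm

theorem omegaPair_self_comm (κ : ℂ) (i j : Fin N) (n : ℕ) :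
    omegaPair κ i j n n = omegaPair κ j i n n := by
  refine Finset.sum_congr rfl fun k _ => ?_
  rw [sub_self]
  rcases eq_or_ne k 0 with rfl | hk
  · simp only [weight_zero, coweight_zero, Nat.sub_zero, add_zero, map_zero, zero_mul]
    ring
  · rw [weight_zero_left hk]
    ring

theorem transp_omegaPair (κ : ℂ) (i j : Fin N) (m n : ℕ) :
    transp i j (omegaPair κ i j m n) = omegaPair κ j i m n := by
  have hi : ∀ l, rename (Equiv.swap i j) (simpleCoeff κ i l) = simpleCoeff κ j l := fun l => by
    rw [← transp, transp_simpleCoeff, Equiv.swap_apply_left]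
  have hj : ∀ l, rename (Equiv.swap i j) (simpleCoeff κ j l) = simpleCoeff κ i l := fun l => by
    rw [← transp, transp_simpleCoeff, Equiv.swap_apply_right]
  simp only [transp, omegaPair, map_sum, map_add, map_mul, rename_C, hi, hj]

theorem dunkl_right_omegaPair_zero {i j : Fin N} (hij : i ≠ j) (κ : ℂ) (m : ℕ) :
    dunkl κ j (omegaPair κ i j m 0) = 0 := by
  rw [omegaPair_zero_right, dunkl_mul_simpleCoeff_zero hij]

theorem dunkl_left_omegaPair_zero {i j : Fin N} (hij : i ≠ j) (κ : ℂ) (m : ℕ) :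
    dunkl κ i (omegaPair κ i j (m + 1) 0) = C (N * κ + m + 1) * omegaPair κ i j m 0 := by
  rw [omegaPair_zero_right, omegaPair_zero_right, dunkl_simpleCoeff_succ_mul hij,
    exchangeTerm_zero_right, mul_zero, add_zero]

theorem dunkl_right_omegaPair_succ {i j : Fin N} (hij : i ≠ j) {κ d : ℂ} {m n : ℕ}
    (hd : (m : ℂ) - (n + 1 : ℕ) = d) (h : ∀ k : ℕ, κ + d + 1 + k ≠ 0) :
    dunkl κ j (omegaPair κ i j m (n + 1)) =
      C ((N - 1) * κ + n + 1) *
        (omegaPair κ i j m n - C (κ / (κ + d + 1)) * omegaPair κ j i m n) := by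
  have hm : (m : ℂ) = d + n + 1 := by rw [← hd]; push_cast; ring
  set x : ℕ → MvPolynomial (Fin N) ℂ := fun k =>
    simpleCoeff κ i (m + k) * simpleCoeff κ j (n - k) with hx
  set y : ℕ → MvPolynomial (Fin N) ℂ := fun k =>
    simpleCoeff κ i (n - k) * simpleCoeff κ j (m + k) with hy
  set Q : ℕ → MvPolynomial (Fin N) ℂ := fun k =>
    exchangeTerm κ i j (m + k) (n + 1 - k) with hQ
  have hQn : Q (n + 1) = 0 := by simp only [hQ, Nat.sub_self, exchangeTerm_zero_right]
  have hQx : ∀ k ∈ Finset.range (n + 1), Q k - Q (k + 1) = x k - y k := fun k hk => by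
    have hk : k ≤ n := Nat.lt_succ_iff.1 (Finset.mem_range.1 hk)
    simp only [hQ, hx, hy]
    rw [Nat.sub_add_comm hk, Nat.add_sub_add_right, ← add_assoc, exchangeTerm_sub]
  have hA : ∀ k ∈ Finset.range (n + 1),
      dunkl κ j (simpleCoeff κ i (m + k) * simpleCoeff κ j (n + 1 - k)) =
        C (N * κ + (n - k) + 1) * x k - C κ * Q k := fun k hk => by
    have hk : k ≤ n := Nat.lt_succ_iff.1 (Finset.mem_range.1 hk)
    simp only [hQ, hx]
    rw [Nat.sub_add_comm hk, dunkl_mul_simpleCoeff_succ hij, Nat.cast_sub hk]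
  -- The last term is annihilated; writing it through `Q (n + 1) = 0` lets the error sum run over
  -- the full range.
  have hA' : dunkl κ j (simpleCoeff κ i (m + (n + 1)) * simpleCoeff κ j (n + 1 - (n + 1))) =
      -(C κ * Q (n + 1)) := by
    rw [hQn, Nat.sub_self, dunkl_mul_simpleCoeff_zero hij, mul_zero, neg_zero]
  -- The index is shifted by one because `coweight κ d 0 = 0` and `D_j` lowers `m + k + 1` to `m +
  -- k`.
  have hB : ∀ k, dunkl κ j (simpleCoeff κ i (n + 1 - (k + 1)) * simpleCoeff κ j (m + (k + 1))) =
        C (N * κ + (m + k) + 1) * y k - C κ * Q (k + 1) := fun k => by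
    simp only [hQ, hy]
    rw [Nat.add_sub_add_right, ← add_assoc, dunkl_mul_simpleCoeff_succ hij, Nat.cast_add,
      exchangeTerm_comm]
  have hlhs : dunkl κ j (omegaPair κ i j m (n + 1)) =
      ∑ k ∈ Finset.range (n + 1), (C (weight κ d k) * (C (N * κ + (n - k) + 1) * x k) +
        C (coweight κ d (k + 1)) * (C (N * κ + (m + k) + 1) * y k)) -
      C κ * ∑ k ∈ Finset.range (n + 2), (C (weight κ d k) + C (coweight κ d k)) * Q k := by
    have hsA := Finset.sum_congr rfl fun k hk => congrArg (C (weight κ d k) * ·) (hA k hk)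
    simp only [omegaPair, hd, dunkl_sum, dunkl_add, dunkl_C_mul, add_mul]
    rw [Finset.sum_add_distrib, Finset.sum_range_succ _ (n + 1),
      Finset.sum_range_succ' _ (n + 1), hsA, hA', Finset.sum_add_distrib,
      Finset.sum_add_distrib, Finset.sum_range_succ _ (n + 1),
      Finset.sum_range_succ' (fun k => C (coweight κ d k) * Q k) (n + 1)]
    simp only [hB, coweight_zero, map_zero, zero_mul, add_zero, mul_sub, Finset.sum_sub_distrib,
      mul_left_comm _ (C κ), ← Finset.mul_sum]
    ring
  rw [hlhs, sum_weight_mul h Q n hQn,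
    Finset.sum_congr rfl fun k hk => congrArg (C (weightSum κ d k) * ·) (hQx k hk)]
  have hd' : (m : ℂ) - n = d + 1 := by rw [hm]; ring
  simp only [omegaPair, hd']
  simp only [Finset.mul_sum, ← Finset.sum_sub_distrib]
  refine Finset.sum_congr rfl fun k _ => ?_
  have c1 := congrArg (C (σ := Fin N)) (weight_right_relation (N := N) (n := n) h k)
  have c2 := congrArg (C (σ := Fin N)) (coweight_right_relation (N := N) hm h k)
  rw [C_sub, C_mul, C_mul, C_mul, C_sub, C_mul] at c1
  rw [C_add, C_mul, C_mul, C_mul, C_sub, C_mul] at c2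
  simp only [hx, hy]
  linear_combination (simpleCoeff κ i (m + k) * simpleCoeff κ j (n - k)) * c1 +
    (simpleCoeff κ i (n - k) * simpleCoeff κ j (m + k)) * c2

theorem dunkl_left_omegaPair_succ {i j : Fin N} (hij : i ≠ j) {κ d : ℂ} {m n : ℕ}
    (hd : (m : ℂ) - n = d) (h : ∀ k : ℕ, κ + d + k ≠ 0) :
    dunkl κ i (omegaPair κ i j (m + 1) (n + 1)) =
      C (N * κ + m + 1) * omegaPair κ i j m (n + 1) +
        C (((N - 1) * κ + n + 1) * κ / (κ + d)) *
          (omegaPair κ j i (m + 1) n - C (κ / (κ + d + 1)) * omegaPair κ i j (m + 1) n) := by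
  have hm : (m : ℂ) = d + n := by rw [← hd]; ring
  have h1 := add_one_add_ne_zero h
  set x : ℕ → MvPolynomial (Fin N) ℂ := fun k =>
    simpleCoeff κ i (m + k) * simpleCoeff κ j (n + 1 - k) with hx
  set y : ℕ → MvPolynomial (Fin N) ℂ := fun k =>
    simpleCoeff κ i (n - k) * simpleCoeff κ j (m + 1 + k) with hy
  set Q : ℕ → MvPolynomial (Fin N) ℂ := fun k =>
    exchangeTerm κ i j (m + 1 + k) (n + 1 - k) with hQ
  have hQn : Q (n + 1) = 0 := by simp only [hQ, Nat.sub_self, exchangeTerm_zero_right]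
  have hx1 : ∀ k, simpleCoeff κ i (m + 1 + k) * simpleCoeff κ j (n - k) = x (k + 1) :=
    fun k => by
      simp only [hx]
      rw [Nat.add_sub_add_right, add_right_comm, add_assoc]
  have hQx : ∀ k ∈ Finset.range (n + 1), Q k - Q (k + 1) = x (k + 1) - y k := fun k hk => by
    have hk : k ≤ n := Nat.lt_succ_iff.1 (Finset.mem_range.1 hk)
    rw [← hx1]
    simp only [hQ, hy]
    rw [Nat.sub_add_comm hk, Nat.add_sub_add_right, ← add_assoc, exchangeTerm_sub]
  have hA : ∀ k, dunkl κ i (simpleCoeff κ i (m + 1 + k) * simpleCoeff κ j (n + 1 - k)) =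
        C (N * κ + (m + k) + 1) * x k + C κ * Q k := fun k => by
    simp only [hQ, hx]
    rw [add_right_comm, dunkl_simpleCoeff_succ_mul hij, Nat.cast_add]
  have hB : ∀ k ∈ Finset.range (n + 1),
      dunkl κ i (simpleCoeff κ i (n + 1 - k) * simpleCoeff κ j (m + 1 + k)) =
        C (N * κ + (n - k) + 1) * y k + C κ * Q k := fun k hk => by
    have hk : k ≤ n := Nat.lt_succ_iff.1 (Finset.mem_range.1 hk)
    simp only [hQ, hy]
    rw [Nat.sub_add_comm hk, dunkl_simpleCoeff_succ_mul hij, Nat.cast_sub hk, exchangeTerm_comm]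
  have hB' : dunkl κ i (simpleCoeff κ i (n + 1 - (n + 1)) * simpleCoeff κ j (m + 1 + (n + 1))) =
      C κ * Q (n + 1) := by
    rw [hQn, Nat.sub_self, dunkl_simpleCoeff_zero_mul hij, mul_zero]
  have hdd : ((m + 1 : ℕ) : ℂ) - (n + 1 : ℕ) = d := by rw [← hd]; push_cast; ring
  have hlhs : dunkl κ i (omegaPair κ i j (m + 1) (n + 1)) =
      C (N * κ + m + 1) * x 0 +
      ∑ k ∈ Finset.range (n + 1),
        (C (weight κ d (k + 1)) * (C (N * κ + (m + (k + 1 : ℕ)) + 1) * x (k + 1)) +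
          C (coweight κ d k) * (C (N * κ + (n - k) + 1) * y k)) +
      C κ * ∑ k ∈ Finset.range (n + 2), (C (weight κ d k) + C (coweight κ d k)) * Q k := by
    have hsB := Finset.sum_congr rfl fun k hk => congrArg (C (coweight κ d k) * ·) (hB k hk)
    simp only [omegaPair, hdd, dunkl_sum, dunkl_add, dunkl_C_mul, add_mul, hA]
    rw [Finset.sum_add_distrib,
      Finset.sum_range_succ (fun k => C (coweight κ d k) * dunkl κ i _) (n + 1), hsB, hB',
      Finset.sum_add_distrib, Finset.sum_add_distrib,
      Finset.sum_range_succ (fun k => C (coweight κ d k) * Q k) (n + 1)]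
    simp only [mul_add, Finset.sum_add_distrib, mul_left_comm _ (C κ), ← Finset.mul_sum]
    rw [Finset.sum_range_succ' (fun k => C (weight κ d k) * (_ * x k)) (n + 1), weight_zero]
    simp only [map_one, one_mul, Nat.cast_zero, add_zero]
    ring
  have hrhs : omegaPair κ i j m (n + 1) = x 0 + ∑ k ∈ Finset.range (n + 1),
      (C (weight κ (d - 1) (k + 1)) * x (k + 1) + C (coweight κ (d - 1) (k + 1)) * y k) := by
    have hd1 : (m : ℂ) - (n + 1 : ℕ) = d - 1 := by rw [← hd]; push_cast; ring
    have hy1 : ∀ k, simpleCoeff κ i (n + 1 - (k + 1)) * simpleCoeff κ j (m + (k + 1)) = y k :=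
      fun k => by
        simp only [hy]
        rw [Nat.add_sub_add_right, add_right_comm, add_assoc]
    rw [omegaPair, Finset.sum_range_succ', add_comm]
    simp only [hd1, hy1, weight_zero, coweight_zero, map_one, map_zero, one_mul, zero_mul,
      add_zero, hx]
  have hd' : ((m + 1 : ℕ) : ℂ) - n = d + 1 := by rw [← hd]; push_cast; ring
  have hyc : ∀ k, simpleCoeff κ j (m + 1 + k) * simpleCoeff κ i (n - k) = y k :=
    fun k => mul_comm _ _
  have hxc : ∀ k, simpleCoeff κ j (n - k) * simpleCoeff κ i (m + 1 + k) = x (k + 1) :=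
    fun k => (mul_comm _ _).trans (hx1 k)
  have hy2 : ∀ k, simpleCoeff κ i (n - k) * simpleCoeff κ j (m + 1 + k) = y k := fun k => rfl
  clear_value x y Q
  rw [hlhs, hrhs, sum_weight_mul h1 Q n hQn,
    Finset.sum_congr rfl fun k hk => congrArg (C (weightSum κ d k) * ·) (hQx k hk)]
  simp only [omegaPair, hd', hyc, hxc, hx1, hy2]
  -- The term `x 0` occurs in no difference `Q k - Q (k + 1)`. Its coefficient is `N κ + m + 1` on
  -- both sides because `weight` is `1` at `0`, so it is split off.
  rw [mul_add (C (N * κ + m + 1)), add_assoc (C (N * κ + m + 1) * x 0),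
    add_assoc (C (N * κ + m + 1) * x 0)]
  refine congrArg (C (N * κ + m + 1) * x 0 + ·) ?_
  simp only [Finset.mul_sum, ← Finset.sum_sub_distrib, ← Finset.sum_add_distrib]
  refine Finset.sum_congr rfl fun k _ => ?_
  have c1 := congrArg (C (σ := Fin N)) (weight_left_relation (N := N) hm h k)
  have c2 := congrArg (C (σ := Fin N)) (coweight_left_relation (N := N) hm h k)
  simp only [C_add, C_mul, C_sub] at c1 c2 ⊢
  linear_combination x (k + 1) * c1 + y k * c2

/-! ### Identification with `omega`, and the three formulas. -/

theorem omegaGe_eq (hN : 2 ≤ N) (κ : ℂ) (m n : ℕ) :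
    omegaGe hN κ m n = omegaPair κ (idx₁ hN) (idx₂ hN) m n := by
  rw [omegaGe, omegaPair, Finset.sum_range_succ', Finset.range_eq_Ico, Finset.sum_Ico_add' (fun k =>
    C (weight κ ((m : ℂ) - n) k) * (simpleCoeff κ (idx₁ hN) (m + k) *
      simpleCoeff κ (idx₂ hN) (n - k)) + C (coweight κ ((m : ℂ) - n) k) *
        (simpleCoeff κ (idx₁ hN) (n - k) * simpleCoeff κ (idx₂ hN) (m + k))) 0 n 1, zero_add,
    add_comm]
  congr 1
  · refine Finset.sum_congr (by ext; simp) fun k hk => ?_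
    obtain ⟨l, rfl⟩ := Nat.exists_eq_add_of_le' (Finset.mem_Icc.1 hk).1
    rw [p_eq, p_eq, mul_add, ← mul_assoc, ← C_mul, ← mul_assoc (C _) (C ((l + 1 : ℕ) : ℂ)),
      ← C_mul]
    congr 3
    · rw [weight, poch_succ ((m : ℂ) - n + 1), Nat.add_sub_cancel, ← add_sub_assoc]
      push_cast
      ring
    · rw [coweight, ← add_sub_assoc]
      ring
  · simp [p_eq, weight_zero, coweight_zero]

theorem omega_of_le (hN : 2 ≤ N) (κ : ℂ) {m n : ℕ} (h : n ≤ m) :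
    omega hN κ m n = omegaPair κ (idx₁ hN) (idx₂ hN) m n := by
  rw [omega, if_neg (by omega), if_pos (by omega), Int.toNat_natCast, Int.toNat_natCast,
    omegaGe_eq]

theorem omega_of_lt (hN : 2 ≤ N) (κ : ℂ) {m n : ℕ} (h : m < n) :
    omega hN κ m n = omegaPair κ (idx₂ hN) (idx₁ hN) n m := by
  rw [omega, if_neg (by omega), if_neg (by omega), Int.toNat_natCast, Int.toNat_natCast,
    omegaGe_eq, transp_omegaPair]

theorem omega_neg_one_left (hN : 2 ≤ N) (κ : ℂ) (n : ℤ) : omega hN κ (-1) n = 0 := by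
  rw [omega, if_pos (by omega)]

theorem omega_neg_one_right (hN : 2 ≤ N) (κ : ℂ) (m : ℤ) : omega hN κ m (-1) = 0 := by
  rw [omega, if_pos (by omega)]

theorem idx₁_ne_idx₂ (hN : 2 ≤ N) : idx₁ hN ≠ idx₂ hN := by
  simp [idx₁, idx₂]

theorem add_natCast_ne_zero {κ : ℂ} (hκ : ∀ k : ℕ, 1 ≤ k → κ ≠ -(k : ℂ)) {k : ℕ} (hk : 1 ≤ k) :
    κ + k ≠ 0 :=
  fun h => hκ k hk (eq_neg_of_add_eq_zero_left h)

end

end SymJack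

theorem mainTheorem2 (N : ℕ) (hN : 2 ≤ N) (κ : ℂ) (hκ : ∀ k : ℕ, 1 ≤ k → κ ≠ -(k : ℂ)) :
    (∀ m n : ℕ, n < m →
      SymJack.dunkl κ (SymJack.idx₁ hN) (SymJack.omega hN κ m n) =
        MvPolynomial.C (N * κ + m) * SymJack.omega hN κ (m - 1) n +
          MvPolynomial.C (((N - 1) * κ + n) * κ / (κ + m - n)) *
            (SymJack.omega hN κ (n - 1) m -
              MvPolynomial.C (κ / (κ + m - n + 1)) * SymJack.omega hN κ m (n - 1))) ∧
    (∀ m n : ℕ, n ≤ m →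
      SymJack.dunkl κ (SymJack.idx₂ hN) (SymJack.omega hN κ m n) =
        MvPolynomial.C ((N - 1) * κ + n) *
          (SymJack.omega hN κ m (n - 1) -
            MvPolynomial.C (κ / (κ + m - n + 1)) * SymJack.omega hN κ (n - 1) m)) ∧
    (∀ n : ℕ,
      SymJack.dunkl κ (SymJack.idx₁ hN) (SymJack.omega hN κ n n) =
        MvPolynomial.C ((N - 1) * κ + n) *
          (SymJack.omega hN κ (n - 1) n -
            MvPolynomial.C (κ / (κ + 1)) * SymJack.omega hN κ n (n - 1))) := by
  have hne := SymJack.idx₁_ne_idx₂ hN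
  have hsub : ∀ n : ℕ, ((n + 1 : ℕ) : ℤ) - 1 = (n : ℕ) := fun n => by push_cast; ring
  have hneg : ((0 : ℕ) : ℤ) - 1 = -1 := by norm_num
  refine ⟨fun m n hnm => ?_, fun m n hnm => ?_, fun n => ?_⟩
  · obtain ⟨m, rfl⟩ : ∃ l, m = l + 1 := ⟨m - 1, by omega⟩
    rw [SymJack.omega_of_le hN κ hnm.le, hsub, SymJack.omega_of_le hN κ (Nat.lt_succ_iff.1 hnm)]
    cases n with
    | zero =>
      rw [hneg, SymJack.omega_neg_one_left, SymJack.omega_neg_one_right,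
        SymJack.dunkl_left_omegaPair_zero hne]
      push_cast
      ring_nf
    | succ n =>
      rw [hsub, SymJack.omega_of_lt hN κ (by omega), SymJack.omega_of_le hN κ (by omega),
        SymJack.dunkl_left_omegaPair_succ hne rfl fun k => ?_]
      · push_cast
        ring_nf
      -- Here `m > n` is essential: it gives `m - n + k ≥ 1` already at `k = 0`, so the denominator
      -- `κ + m - n` is nonzero.
      · have := SymJack.add_natCast_ne_zero hκ (k := m - n + k) (by omega)
        rw [Nat.cast_add, Nat.cast_sub (by omega)] at this
        rwa [add_assoc]
  · rw [SymJack.omega_of_le hN κ hnm]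
    cases n with
    | zero =>
      rw [hneg, SymJack.omega_neg_one_left, SymJack.omega_neg_one_right,
        SymJack.dunkl_right_omegaPair_zero hne]
      simp
    | succ n =>
      rw [hsub, SymJack.omega_of_lt hN κ (m := n) (n := m) hnm,
        SymJack.omega_of_le hN κ (m := m) (n := n) (by omega),
        SymJack.dunkl_right_omegaPair_succ hne rfl fun k => ?_]
      · rw [add_sub_assoc κ, Nat.cast_add_one n, ← add_assoc ((_ - 1) * κ)]
      · have := SymJack.add_natCast_ne_zero hκ (k := m - (n + 1) + 1 + k) (by omega)
        rw [Nat.cast_add, Nat.cast_add, Nat.cast_sub hnm, Nat.cast_one] at this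
        convert this using 1
        ring
  -- By symmetry of `ω_{nn}`, `D_1` acts as the right-hand operator of the pair `(x_2, x_1)`.
  · rw [SymJack.omega_of_le hN κ le_rfl, SymJack.omegaPair_self_comm]
    cases n with
    | zero =>
      rw [hneg, SymJack.omega_neg_one_left, SymJack.omega_neg_one_right,
        SymJack.dunkl_right_omegaPair_zero hne.symm]
      simp
    | succ n =>
      rw [hsub, SymJack.omega_of_lt hN κ (by omega), SymJack.omega_of_le hN κ (by omega),
        SymJack.dunkl_right_omegaPair_succ hne.symm (d := 0) (sub_self _) fun k => ?_]
      · rw [add_zero, Nat.cast_add_one n, ← add_assoc ((_ - 1) * κ)]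
      · have := SymJack.add_natCast_ne_zero hκ (k := 1 + k) (by omega)
        rw [Nat.cast_add, Nat.cast_one] at this
        convert this using 1
        ring
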